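/- A 3-CNF formula $\Phi$ consists of a finite set $X$ of variables and a set $\mathcal{C}$ of clauses, each an OR of at most 3 literals; $\mathrm{val}(\Phi)$ is the maximum, over all assignments $X\to\{0,1\}$, of the fraction of satisfied clauses. For $T\subseteq\mathcal{C}$, $\mathrm{var}(T)$ is the set of variables appearing in at least one clause of $T$. Given $\Phi$, a collection $\mathcal{T}=(T_1,\dots,T_k)$ of subsets of $\mathcal{C}$ and an integer $t\ge 2$, the Label Cover instance $\mathcal{L}_{\Phi,\mathcal{T},t}$ has left vertices $T_1,\dots,T_k$; right vertices all $t$-element subcollections of $\mathcal{T}$; an edge between $T_i$ and each subcollection that contains it; the alphabet of $T_i$ is the set of assignments to $\mathrm{var}(T_i)$ that satisfy all clauses of $T_i$; the alphabet of $\{T_{i_1},\dots,T_{i_t}\}$ is the set of all assignments to $\bigcap_{j}\mathrm{var}(T_{i_j})$; and the projection on each edge is restriction of assignments to this intersection. A left labeling $\sigma$ chooses a label $\sigma_u$ from the alphabet of each left vertex $u$. It weakly agrees on a right vertex $v$ if two distinct neighbours $u_1\neq u_2$ of $v$ satisfy $\pi_{(u_1,v)}(\sigma_{u_1})=\pi_{(u_2,v)}(\sigma_{u_2})$.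 The weak agreement value $\mathrm{wval}(\mathcal{L})$ is the maximum over all left labelings of the fraction of right vertices on which the labeling weakly agrees (and $0$ if there is no left labeling). Theorem. For all $\varepsilon,\delta>0$ and $\Delta,t\in\mathbb{N}$ with $t\ge2$ there is a constant $C=C(\varepsilon,\Delta,\delta,t)>0$ such that for every sufficiently large $k$ (depending on $\varepsilon,\Delta,\delta,t$) the following holds. Let $\Phi$ be a 3-CNF formula with $n$ variables, each of which appears in at least one and at most $\Delta$ clauses, and with $\mathrm{val}(\Phi)<1-\varepsilon$. Let $T_1,\dots,T_k$ be random subsets of the clauses of $\Phi$, where each clause is included in each subset independently with probability $p=C/k$. Then $\mathrm{wval}(\mathcal{L}_{\Phi,\mathcal{T},t})<\delta$ with high probability, i.e. with probability tending to $1$ as $n\to\infty$, uniformly over such $\Phi$: for every $\eta>0$ there is $n_0$ (depending only on $\varepsilon,\delta,\Delta,t,k,\eta$) such that the probability is at least $1-\eta$ whenever $n\ge n_0$. -/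

import Mathlib

open MeasureTheory ProbabilityTheory

noncomputable section

/-! ### 3-CNF formulas -/

/-- A literal over the variables `X`: `(x, true)` is the literal `x`, and `(x, false)` is the
literal `¬ x`. -/
abbrev Literal (X : Type*) := X × Bool

/-- A 3-CNF formula over the set `X` of variables: a finite set of clauses, each of which is an OR
of at most three literals. -/
structure ThreeCNF (X : Type*) where
  clauses : Finset (Finset (Literal X))
  card_le_three : ∀ c ∈ clauses, c.card ≤ 3

namespace ThreeCNF

variable {X : Type*} (Φ : ThreeCNF X)

/-- The type of clauses of `Φ`. -/
abbrev Clause := {c : Finset (Literal X) // c ∈ Φ.clauses}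

variable {Φ}

/-- The set of variables that appear in the clause `c`. -/
def clauseVar (c : Φ.Clause) : Set X := {x | ∃ b : Bool, (x, b) ∈ c.1}

/-- The set of variables that appear in at least one clause of `T`. -/
def subsetVar (T : Set Φ.Clause) : Set X := ⋃ c ∈ T, clauseVar c

/-- The clause `c` is satisfied by the assignment `φ` of all the variables. -/
def Satisfies (φ : X → Bool) (c : Φ.Clause) : Prop := ∃ l ∈ c.1, φ l.1 = l.2

/-- The clause `c` is satisfied by the partial assignment `φ`, which is defined on `S` only. -/
def PartialSatisfies {S : Set X} (φ : S → Bool) (c : Φ.Clause) : Prop :=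
  ∃ l ∈ c.1, ∃ h : l.1 ∈ S, φ ⟨l.1, h⟩ = l.2

variable (Φ)

/-- The number of clauses in which the variable `x` appears. -/
def degree (x : X) : ℕ := {c : Φ.Clause | x ∈ clauseVar c}.ncard

/-- The fraction of clauses satisfied by the assignment `φ`. -/
def valOf (φ : X → Bool) : ℝ := ({c : Φ.Clause | Satisfies φ c}.ncard : ℝ) / Φ.clauses.card

/-- The value of `Φ`: the maximum of the values of its assignments. -/
def val : ℝ := ⨆ φ : X → Bool, Φ.valOf φ

end ThreeCNF

/-! ### Label Cover -/

/-- A Label Cover instance (projection game): a finite bipartite graph between `U` and `V`, a finite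
alphabet for every vertex, and a projection for every edge. -/
structure LabelCover.{u, v} where
  U : Type u
  V : Type u
  Adj : U → V → Prop
  LeftAlphabet : U → Type v
  RightAlphabet : V → Type v
  proj : ∀ (u : U) (v : V), Adj u v → LeftAlphabet u → RightAlphabet v
  finite_U : Finite U
  finite_V : Finite V
  finite_left : ∀ u, Finite (LeftAlphabet u)
  finite_right : ∀ v, Finite (RightAlphabet v)

namespace LabelCover

variable (L : LabelCover)

/-- A left labeling. -/
abbrev LeftLabeling := ∀ u : L.U, L.LeftAlphabet u

variable {L}

/-- The left labeling `σ` weakly agrees on the right vertex `v`: two distinct neighbours of `v` have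
labels that project to the same label of `v`. -/
def WeaklyAgrees (σ : L.LeftLabeling) (v : L.V) : Prop :=
  ∃ (u₁ u₂ : L.U) (h₁ : L.Adj u₁ v) (h₂ : L.Adj u₂ v),
    u₁ ≠ u₂ ∧ L.proj u₁ v h₁ (σ u₁) = L.proj u₂ v h₂ (σ u₂)

/-- The fraction of right vertices on which `σ` weakly agrees. -/
def wvalOf (σ : L.LeftLabeling) : ℝ := ({v : L.V | WeaklyAgrees σ v}.ncard : ℝ) / Nat.card L.V

variable (L)

/-- The weak agreement value of `L`: the maximum of the weak agreement values of its left labelings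
(which is `0` if there is no left labeling at all). -/
def wval : ℝ := ⨆ σ : L.LeftLabeling, wvalOf σ

end LabelCover

/-! ### The reduction -/

/-- The Label Cover instance built from the 3-CNF formula `Φ`, the collection `T` of `k` subsets of
its clauses and the integer `t`. The left vertices are the members of the collection, and the
labels of `T i` are the assignments to the variables of `T i` that satisfy all clauses in `T i`. The
right vertices are the `t`-element subcollections, and the labels of such a subcollection are the
assignments to the variables common to all its members. Projections are restrictions. -/
def ThreeCNF.labelCover {X : Type*} [Finite X] (Φ : ThreeCNF X) {k : ℕ}
    (T : Fin k → Set Φ.Clause) (t : ℕ) : LabelCover where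
  U := Fin k
  V := {s : Finset (Fin k) // s.card = t}
  Adj i s := i ∈ s.1
  LeftAlphabet i :=
    {φ : ThreeCNF.subsetVar (T i) → Bool // ∀ c ∈ T i, ThreeCNF.PartialSatisfies φ c}
  RightAlphabet s := ((⋂ i ∈ s.1, ThreeCNF.subsetVar (T i) : Set X) → Bool)
  proj i _ hi φ := fun x => φ.1 ⟨x.1, Set.mem_iInter₂.mp x.2 i hi⟩
  finite_U := inferInstance
  finite_V := inferInstance
  finite_left _ := inferInstance
  finite_right _ := inferInstance

/-- The law of `k` independent random subsets of `α`, each of which contains each element of `α`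
independently with probability `p`. -/
def randomSubsets (α : Type*) (k : ℕ) (p : unitInterval) : Measure (Fin k → Set α) :=
  Measure.pi fun _ => setBernoulli Set.univ p

end

/-! Let `A x` be the set of indices `i` such that `T i` mentions the variable `x`. Suppose that a
labeling weakly agrees on a `δ` fraction of the right vertices. By averaging, there is a dense graph
of pairs `i, j` such that the two labels agree on a positive proportion of the `t`-sets containing
both. Agreement on a `t`-set concerns only the few variables shared by all its members, but for most
`x` a set `A x` that contains `i` and `j` also contains one of these `t`-sets, found by adding
indices one at a time (`Rich.exists_subset`). So the two labels agree at almost all the variables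
they share. Dependent random choice (`exists_subset_codegree`) yields linearly many indices `U`, any
two joined by many paths of length four in this graph. Outside a small set of variables, all labels
from `U` are then consistent (`exists_consistent_indices`). Reading each variable off any label from
`U` satisfies every clause that occurs in some `T i`, `i ∈ U`, and has no exceptional variable. The
remaining clauses are a fraction `exp (-β C)` times a polynomial in `C`, at most `ε` for large `C`,
contradicting `val Φ < 1 - ε`. Randomness enters only through counts: for disjoint `τ, N`, the
number of `x` with `τ ⊆ A x` and `A x` disjoint from `N` is not much above its expected bound, and
similarly for clauses. Dependencies have bounded degree, so Chebyshev and a union bound over at most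
`4 ^ k` patterns suffice, `k` being fixed as `n` grows. This is a property of `T` alone, so no union
bound over labelings is needed. -/

/-! ### Extending small sets along a dense family -/

section Combinatorics

open Finset
open scoped Classical

variable {V : Type*} [Fintype V]

/-- The number of supersets of `τ` with `m` additional elements that have the property `P`. -/
noncomputable def superCount (P : Finset V → Prop) (m : ℕ) (τ : Finset V) : ℕ :=
  #{s : Finset V | τ ⊆ s ∧ #s = #τ + m ∧ P s}

lemma superCount_succ_le (P : Finset V → Prop) (m : ℕ) (τ : Finset V) :
    superCount P (m + 1) τ ≤ ∑ v ∈ τᶜ, superCount P m (insert v τ) := by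
  refine le_trans (card_le_card ?_) card_biUnion_le
  intro s hs
  simp only [mem_filter, mem_univ, true_and, mem_biUnion, mem_compl] at hs ⊢
  obtain ⟨h1, h2, h3⟩ := hs
  obtain ⟨v, hv, hv'⟩ := exists_of_ssubset (ssubset_of_subset_of_ne h1 (by rintro rfl; omega))
  refine ⟨v, hv', insert_subset hv h1, ?_, h3⟩
  rw [card_insert_of_notMem hv']; omega

lemma superCount_le (P : Finset V → Prop) (m : ℕ) (τ : Finset V) :
    superCount P m τ ≤ Fintype.card V ^ m := by
  induction m generalizing τ with
  | zero =>
    refine card_le_one.2 ?_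
    intro a ha b hb
    simp only [mem_filter, mem_univ, true_and, add_zero] at ha hb
    rw [← eq_of_subset_of_card_le ha.1 ha.2.1.le, ← eq_of_subset_of_card_le hb.1 hb.2.1.le]
  | succ m ih =>
    calc superCount P (m + 1) τ ≤ ∑ v ∈ τᶜ, superCount P m (insert v τ) := superCount_succ_le ..
      _ ≤ ∑ v ∈ τᶜ, Fintype.card V ^ m := sum_le_sum fun v _ => ih _
      _ = #τᶜ * Fintype.card V ^ m := by simp
      _ ≤ Fintype.card V * Fintype.card V ^ m := Nat.mul_le_mul_right _ (card_le_univ _)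
      _ = _ := by ring

/-- A positive proportion of the supersets of `τ` with `m` additional elements satisfies `P`. -/
def Rich (P : Finset V → Prop) (β : ℝ) (m : ℕ) (τ : Finset V) : Prop :=
  (m + 1) * β * (Fintype.card V : ℝ) ^ m ≤ superCount P m τ

lemma Rich.of_zero {P : Finset V → Prop} {β : ℝ} (hβ : 0 < β) {τ : Finset V}
    (h : Rich P β 0 τ) : P τ := by
  have h' : (0 : ℝ) < superCount P 0 τ := lt_of_lt_of_le (by simpa using hβ) h
  have h0 : 0 < superCount P 0 τ := by exact_mod_cast h'
  obtain ⟨s, hs⟩ := card_pos.1 h0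
  simp only [mem_filter, mem_univ, true_and, add_zero] at hs
  rw [eq_of_subset_of_card_le hs.1 hs.2.1.le]
  exact hs.2.2

/-- The factor `m + 1` in `Rich` pays for this step. Extensions that are not rich account for at
most `(m + 1) β K ^ (m + 1)` supersets, `K` being the size of `V`. What is left is at least `β K ^
(m + 1)`, and each rich extension covers at most `K ^ m`. -/
lemma Rich.succ {P : Finset V → Prop} {β : ℝ} {m : ℕ} {τ : Finset V} (hβ : 0 ≤ β)
    (h : Rich P β (m + 1) τ) :
    β * Fintype.card V ≤ #{v | v ∉ τ ∧ Rich P β m (insert v τ)} := by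
  set K : ℝ := (Fintype.card V : ℝ) with hK
  have hK0 : 0 ≤ K := by positivity
  set N : Finset V := {v | v ∉ τ ∧ Rich P β m (insert v τ)} with hN
  rcases hK0.eq_or_lt with h0 | hKpos
  · rw [← h0]; simp
  have h1 : (superCount P (m + 1) τ : ℝ) ≤ ∑ v ∈ τᶜ, (superCount P m (insert v τ) : ℝ) := by
    exact_mod_cast superCount_succ_le P m τ
  have h2 : ∀ v ∈ τᶜ, (superCount P m (insert v τ) : ℝ) ≤
      (if v ∈ N then K ^ m else 0) + (m + 1) * β * K ^ m := by
    intro v hv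
    have hub : (superCount P m (insert v τ) : ℝ) ≤ K ^ m := by
      rw [hK]; exact_mod_cast superCount_le P m _
    have hnn : 0 ≤ (m + 1) * β * K ^ m := by positivity
    split_ifs with hvN
    · linarith
    · have : ¬ Rich P β m (insert v τ) := fun hr => hvN (by simp [hN, hr, mem_compl.1 hv])
      unfold Rich at this
      push Not at this
      linarith
  have h3 : (superCount P (m + 1) τ : ℝ) ≤ #N * K ^ m + K * ((m + 1) * β * K ^ m) := by
    refine h1.trans ((sum_le_sum h2).trans ?_)
    rw [sum_add_distrib]
    refine add_le_add ?_ ?_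
    · rw [← sum_filter, sum_const, nsmul_eq_mul]
      gcongr
      exact fun v hv => (mem_filter.1 hv).2
    · rw [sum_const, nsmul_eq_mul]
      gcongr
      rw [hK]; exact_mod_cast card_le_univ _
  have h4 : ((m + 1 : ℕ) + 1) * β * K ^ (m + 1) ≤ superCount P (m + 1) τ := h
  push_cast at h4
  have h5 : β * K * K ^ m ≤ #N * K ^ m := by
    have : ((m : ℝ) + 1 + 1) * β * K ^ (m + 1) = K * ((m + 1) * β * K ^ m) + β * K * K ^ m := by
      ring
    linarith
  exact le_of_mul_le_mul_right h5 (by positivity)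

/-- A set that meets the rich one-element extensions of all of its small subsets contains a superset
of `τ` with the property `P`. -/
lemma Rich.exists_subset {P : Finset V → Prop} {β : ℝ} (hβ : 0 < β) {t m : ℕ} {τ A : Finset V}
    (h : Rich P β m τ) (hτ : τ ⊆ A) (ht : #τ + m = t)
    (hA : ∀ ρ, τ ⊆ ρ → ρ ⊆ A → #ρ ≤ t →
      β * Fintype.card V ≤ #{v | v ∉ ρ ∧ Rich P β (t - #ρ - 1) (insert v ρ)} →
      ¬ Disjoint A ({v | v ∉ ρ ∧ Rich P β (t - #ρ - 1) (insert v ρ)} : Finset V)) :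
    ∃ s ⊆ A, P s := by
  induction m generalizing τ with
  | zero => exact ⟨τ, hτ, h.of_zero hβ⟩
  | succ m ih =>
    -- Since `#τ + m = t` is invariant, the remaining depth is determined by the set alone, so `hA`
    -- need not mention `m`.
    have hm : t - #τ - 1 = m := by omega
    have := hA τ subset_rfl hτ (by omega) (by rw [hm]; exact h.succ hβ.le)
    rw [hm, not_disjoint_iff] at this
    obtain ⟨v, hvA, hv⟩ := this
    simp only [mem_filter, mem_univ, true_and] at hv
    refine ih hv.2 (insert_subset hvA hτ) (by rw [card_insert_of_notMem hv.1]; omega) ?_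
    exact fun ρ h1 => hA ρ ((subset_insert _ _).trans h1)

/-! ### Dependent random choice -/

/-- In a dense relation there is a large set `U` any two elements of which are joined by many paths
of length two through pairs of linear codegree. -/
lemma exists_subset_codegree (E : V → V → Prop) {α : ℝ} (hα : 0 < α) (hV : 0 < Fintype.card V)
    (hE : α * (Fintype.card V : ℝ) ^ 2 ≤ #{q : V × V | E q.1 q.2}) {β : ℝ}
    (hβ : β ≤ α ^ 2 / 64) (hβ' : β ≤ α / 4) :
    ∃ U : Finset V, β * Fintype.card V ≤ #U ∧ ∀ u ∈ U, ∀ u' ∈ U,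
      β * Fintype.card V ≤ #{w | β * Fintype.card V ≤ #{y | E u y ∧ E w y} ∧
        β * Fintype.card V ≤ #{y | E u' y ∧ E w y}} := by
  set K : ℝ := (Fintype.card V : ℝ) with hK
  have hKpos : 0 < K := by rw [hK]; exact_mod_cast hV
  let ok : V → V → Prop := fun a b => β * K ≤ #{y | E a y ∧ E b y}
  let d : V → ℕ := fun v => #{a | E a v}
  let b : V → ℕ := fun v => #{q : V × V | (E q.1 v ∧ E q.2 v) ∧ ¬ ok q.1 q.2}
  have hd : α * K ^ 2 ≤ ∑ v, (d v : ℝ) := by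
    refine hE.trans (le_of_eq ?_)
    have : #{q : V × V | E q.1 q.2} = ∑ v, d v := by
      simp only [d, card_filter, Fintype.sum_prod_type]
      rw [sum_comm]
    exact_mod_cast this
  have hd2 : α ^ 2 * K ^ 3 ≤ ∑ v, (d v : ℝ) ^ 2 := by
    have h := sq_sum_le_card_mul_sum_sq (s := (univ : Finset V)) (f := fun v => (d v : ℝ))
    rw [card_univ, ← hK] at h
    have h' : (α * K ^ 2) ^ 2 ≤ (∑ v, (d v : ℝ)) ^ 2 := by gcongr
    have : K * (α ^ 2 * K ^ 3) ≤ K * ∑ v, (d v : ℝ) ^ 2 := by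
      calc _ = (α * K ^ 2) ^ 2 := by ring
        _ ≤ _ := h'.trans h
    exact le_of_mul_le_mul_left this hKpos
  -- Each pair of low codegree lies in fewer than `β K` neighbourhoods. For negative `β` there is no
  -- such pair.
  have hb : ∑ v, (b v : ℝ) ≤ β * K ^ 3 ∨ ∑ v, (b v : ℝ) = 0 := by
    by_cases h0 : 0 ≤ β
    swap
    · right
      refine sum_eq_zero fun v _ => ?_
      simp only [b, Nat.cast_eq_zero, card_eq_zero, filter_eq_empty_iff]
      rintro q - ⟨-, hq⟩
      refine hq (le_trans ?_ (Nat.cast_nonneg _))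
      push Not at h0
      nlinarith
    left
    have e : ∑ v, b v = ∑ q : V × V, if ok q.1 q.2 then 0 else #{y | E q.1 y ∧ E q.2 y} := by
      simp only [b, card_filter]
      rw [sum_comm]
      refine sum_congr rfl fun q _ => ?_
      split_ifs with h <;> simp [h]
    have e' : ∑ v, (b v : ℝ) =
        ∑ q : V × V, if ok q.1 q.2 then (0 : ℝ) else #{y | E q.1 y ∧ E q.2 y} := by
      exact_mod_cast e
    rw [e']
    calc _ ≤ ∑ q : V × V, β * K := by
          refine sum_le_sum fun q _ => ?_
          split_ifs with h
          · positivity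
          · exact (not_le.1 h).le
      _ = β * K ^ 3 := by simp [hK]; ring
  -- The weight 32 turns `β ≤ α ^ 2 / 64` into a loss of at most half of the second moment. One `v`
  -- then has both a large neighbourhood and a small share of bad pairs.
  have hsum : ∑ v : V, α ^ 2 * K ^ 2 / 2 ≤ ∑ v, ((d v : ℝ) ^ 2 - 32 * b v) := by
    rw [sum_sub_distrib, ← mul_sum, sum_const, card_univ, nsmul_eq_mul, ← hK]
    have : β * K ^ 3 ≤ α ^ 2 / 64 * K ^ 3 := by gcongr
    have h3 : 0 ≤ α ^ 2 * K ^ 3 := by positivity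
    rcases hb with h | h
    · nlinarith
    · rw [h]; nlinarith
  have : Nonempty V := Fintype.card_pos_iff.1 hV
  obtain ⟨v, -, hv⟩ := exists_le_of_sum_le univ_nonempty hsum
  have hdv : α / 2 * K ≤ d v := by
    refine (sq_le_sq₀ (by positivity) (by positivity)).1 ?_
    have : (0 : ℝ) ≤ b v := by positivity
    have h3 : 0 ≤ α ^ 2 * K ^ 2 := by positivity
    nlinarith
  have hbv : 32 * (b v : ℝ) ≤ (d v : ℝ) ^ 2 := by
    have h3 : 0 ≤ α ^ 2 * K ^ 2 := by positivity
    linarith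
  have hdpos : (0 : ℝ) < d v := lt_of_lt_of_le (by positivity) hdv
  let Uv : Finset V := {a | E a v}
  let bad : V → Finset V := fun a => {c ∈ Uv | ¬ ok a c}
  -- By Markov, at most `d v / 8` vertices of `Uv` are discarded. Two vertices of `U` have at most
  -- `d v / 2` bad partners together, so at least `d v / 2` vertices of `Uv` are good for both.
  let U : Finset V := {a ∈ Uv | (#(bad a) : ℝ) ≤ d v / 4}
  have hbsum : (b v : ℝ) = ∑ a ∈ Uv, (#(bad a) : ℝ) := by
    have : b v = ∑ a ∈ Uv, #(bad a) := by
      rw [← card_sigma]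
      refine card_bij' (fun q _ => ⟨q.1, q.2⟩) (fun q _ => (q.1, q.2)) ?_ ?_ ?_ ?_ <;>
        simp +contextual [Uv, bad]
    exact_mod_cast this
  have hUc : (#(Uv \ U) : ℝ) * (d v / 4) ≤ (d v : ℝ) ^ 2 / 32 := by
    calc (#(Uv \ U) : ℝ) * (d v / 4) = ∑ a ∈ Uv \ U, (d v / 4 : ℝ) := by simp
      _ ≤ ∑ a ∈ Uv \ U, (#(bad a) : ℝ) := by
          refine sum_le_sum fun a ha => ?_
          simp only [U, mem_sdiff, mem_filter, not_and, not_le] at ha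
          exact (ha.2 ha.1).le
      _ ≤ ∑ a ∈ Uv, (#(bad a) : ℝ) :=
          sum_le_sum_of_subset_of_nonneg sdiff_subset fun _ _ _ => by positivity
      _ ≤ _ := by rw [← hbsum]; linarith
  have hUc' : (#(Uv \ U) : ℝ) ≤ d v / 8 := by
    refine le_of_mul_le_mul_right (hUc.trans (le_of_eq ?_)) (by positivity : (0 : ℝ) < d v / 4)
    ring
  have hUcard : (#Uv : ℝ) = #(Uv \ U) + #U := by
    exact_mod_cast (card_sdiff_add_card_eq_card (filter_subset _ _)).symm
  have hUv : (#Uv : ℝ) = d v := rfl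
  refine ⟨U, ?_, fun u hu u' hu' => ?_⟩
  · have : β * K ≤ α / 4 * K := by gcongr
    linarith
  · have hs : Uv ⊆ ({w | ok u w ∧ ok u' w} : Finset V) ∪ (bad u ∪ bad u') := by
      intro w hw
      simp only [mem_union, mem_filter, mem_univ, true_and, bad, hw]
      tauto
    have hc : (#Uv : ℝ) ≤ #({w | ok u w ∧ ok u' w} : Finset V) + (#(bad u) + #(bad u')) := by
      exact_mod_cast (card_le_card hs).trans ((card_union_le _ _).trans
        (add_le_add_right (card_union_le _ _) _))
    have h1 := (mem_filter.1 hu).2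
    have h2 := (mem_filter.1 hu').2
    have : β * K ≤ α / 4 * K := by gcongr
    change β * K ≤ (#({w | ok u w ∧ ok u' w} : Finset V) : ℝ)
    linarith

end Combinatorics

/-! ### From weak agreement to a consistent assignment -/

section Consistency

open Finset
open scoped Classical

variable {X V : Type*} [Fintype X] [Fintype V]

/-- A union bound over `ρ` and `(i, j)`. The target set is determined by at most `t` indices, and
the at most `K ^ q` choices of `ρ` of size `q` cancel the `K ^ q` in the denominator of `hA`. Hence
the bound does not grow with the number `K` of indices. -/
lemma exists_small_exceptional (A : X → Finset V) (N : V → V → Finset V → Finset V) {t : ℕ}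
    {b M D : ℝ} (hV : 0 < Fintype.card V) (hD : 1 ≤ D) (hM : 0 ≤ M)
    (hA : ∀ τ N : Finset V, b ≤ #N → #τ ≤ t →
      (#{x | τ ⊆ A x ∧ Disjoint (A x) N} : ℝ) ≤ M * (D / Fintype.card V) ^ #τ) :
    ∃ B : Finset X, (#B : ℝ) ≤ (t + 1) * (t ^ 2 * (M * D ^ t)) ∧
      ∀ x ∉ B, ∀ ρ ⊆ A x, #ρ ≤ t → ∀ i ∈ ρ, ∀ j ∈ ρ, b ≤ #(N i j ρ) →
        ¬ Disjoint (A x) (N i j ρ) := by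
  set K : ℝ := (Fintype.card V : ℝ) with hK
  have hKpos : 0 < K := by rw [hK]; exact_mod_cast hV
  let I : Finset V → Finset (V × V) := fun ρ => {q ∈ ρ ×ˢ ρ | b ≤ #(N q.1 q.2 ρ)}
  let F : Finset V → V × V → Finset X := fun ρ q => {x | ρ ⊆ A x ∧ Disjoint (A x) (N q.1 q.2 ρ)}
  let B : Finset X := (range (t + 1)).biUnion fun q => (powersetCard q univ).biUnion fun ρ =>
    (I ρ).biUnion (F ρ)
  have h1 : ∀ q ≤ t, ∀ ρ ∈ powersetCard q (univ : Finset V),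
      (#((I ρ).biUnion (F ρ)) : ℝ) ≤ t ^ 2 * (M * (D / K) ^ q) := by
    intro q hq ρ hρ
    have hc := (mem_powersetCard.1 hρ).2
    calc (#((I ρ).biUnion (F ρ)) : ℝ) ≤ ∑ r ∈ I ρ, (#(F ρ r) : ℝ) := by
          exact_mod_cast card_biUnion_le
      _ ≤ ∑ r ∈ I ρ, M * (D / K) ^ q := by
          refine sum_le_sum fun r hr => ?_
          have := hA ρ (N r.1 r.2 ρ) (mem_filter.1 hr).2 (by omega)
          rwa [hc] at this
      _ = #(I ρ) * (M * (D / K) ^ q) := by simp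
      _ ≤ _ := by
          gcongr
          have : #(I ρ) ≤ t ^ 2 := by
            refine (card_filter_le _ _).trans ?_
            rw [card_product, hc, sq]
            exact Nat.mul_le_mul hq hq
          exact_mod_cast this
  have h2 : ∀ q ≤ t, (#((powersetCard q (univ : Finset V)).biUnion fun ρ => (I ρ).biUnion (F ρ)) : ℝ)
      ≤ t ^ 2 * (M * D ^ t) := by
    intro q hq
    calc _ ≤ ∑ ρ ∈ powersetCard q (univ : Finset V), (#((I ρ).biUnion (F ρ)) : ℝ) := by
          exact_mod_cast card_biUnion_le
      _ ≤ ∑ ρ ∈ powersetCard q (univ : Finset V), t ^ 2 * (M * (D / K) ^ q) :=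
          sum_le_sum (h1 q hq)
      _ = ((Fintype.card V).choose q : ℝ) * (t ^ 2 * (M * (D / K) ^ q)) := by
          rw [sum_const, card_powersetCard, card_univ, nsmul_eq_mul]
      _ ≤ K ^ q * (t ^ 2 * (M * (D / K) ^ q)) := by
          gcongr
          rw [hK]; exact_mod_cast Nat.choose_le_pow _ _
      _ = t ^ 2 * (M * D ^ q) := by rw [div_pow]; field_simp
      _ ≤ _ := by gcongr
  refine ⟨B, ?_, ?_⟩
  · calc (#B : ℝ) ≤ ∑ q ∈ range (t + 1),
          (#((powersetCard q (univ : Finset V)).biUnion fun ρ => (I ρ).biUnion (F ρ)) : ℝ) := by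
          exact_mod_cast card_biUnion_le
      _ ≤ ∑ q ∈ range (t + 1), (t ^ 2 * (M * D ^ t) : ℝ) :=
          sum_le_sum fun q hq => h2 q (by simpa [Nat.lt_succ_iff] using hq)
      _ = _ := by simp
  · intro x hx ρ hρ hρt i hi j hj hb hdis
    refine hx ?_
    simp only [B, mem_biUnion]
    exact ⟨#ρ, by simp; omega, ρ, by simp, (i, j), by simp [I, hi, hj, hb], by simp [F, hρ, hdis]⟩

/-- If the sets `A x` are pseudorandom, and the local assignments `s i` weakly agree on a positive
proportion of the `t`-sets, then there is a large set of indices on which almost all the variables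
are assigned consistently. -/
theorem exists_consistent_indices (A : X → Finset V) (s : V → X → Bool) {t : ℕ} (ht : 2 ≤ t)
    {α β M D : ℝ} (hβ : 0 < β) (hβt : β * (2 * t) ≤ α) (hβα : β ≤ (α / 2) ^ 2 / 64)
    (hβα' : β ≤ (α / 2) / 4) (hV : 0 < Fintype.card V) (hD : 1 ≤ D) (hM : 0 ≤ M)
    (hagree : α * (Fintype.card V : ℝ) ^ t ≤ #{S : Finset V | #S = t ∧
      ∃ i ∈ S, ∃ j ∈ S, i ≠ j ∧ ∀ x, S ⊆ A x → s i x = s j x})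
    (hA : ∀ τ N : Finset V, β * Fintype.card V ≤ #N → #τ ≤ t →
      (#{x | τ ⊆ A x ∧ Disjoint (A x) N} : ℝ) ≤ M * (D / Fintype.card V) ^ #τ) :
    ∃ (U : Finset V) (B : Finset X), β * Fintype.card V ≤ #U ∧
      (#B : ℝ) ≤ 3 * ((t + 1) * (t ^ 2 * (M * D ^ t))) ∧
      ∀ x ∉ B, ∀ u ∈ U, u ∈ A x → ∀ u' ∈ U, u' ∈ A x → s u x = s u' x := by
  set K : ℝ := (Fintype.card V : ℝ) with hK
  have hKpos : 0 < K := by rw [hK]; exact_mod_cast hV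
  have htpos : (0 : ℝ) < t := by positivity
  have hα : 0 < α := lt_of_lt_of_le (by positivity) hβt
  let P : V → V → Finset V → Prop := fun i j S => ∀ x, S ⊆ A x → s i x = s j x
  let E : V → V → Prop := fun i j => i ≠ j ∧ Rich (P i j) β (t - 2) {i, j}
  -- Pairs that are not rich account for at most `t β K ^ t ≤ α / 2 * K ^ t` of the agreeing
  -- `t`-sets.
  have hE : α / 2 * K ^ 2 ≤ #{q : V × V | E q.1 q.2} := by
    set O : Finset (V × V) := {q | q.1 ≠ q.2} with hO
    have h1 : #{S : Finset V | #S = t ∧ ∃ i ∈ S, ∃ j ∈ S, i ≠ j ∧ P i j S} ≤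
        ∑ q ∈ O, superCount (P q.1 q.2) (t - 2) {q.1, q.2} := by
      refine le_trans (card_le_card ?_) card_biUnion_le
      intro S hS
      simp only [mem_filter, mem_univ, true_and, mem_biUnion, hO] at hS ⊢
      obtain ⟨hc, i, hi, j, hj, hij, hP⟩ := hS
      refine ⟨(i, j), hij, ?_, ?_, hP⟩
      · exact insert_subset hi (singleton_subset_iff.2 hj)
      · rw [card_pair hij]; omega
    have h2 : α * K ^ t ≤ ∑ q ∈ O, (superCount (P q.1 q.2) (t - 2) {q.1, q.2} : ℝ) :=
      hagree.trans (by exact_mod_cast h1)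
    have h3 : ∀ q ∈ O, (superCount (P q.1 q.2) (t - 2) {q.1, q.2} : ℝ) ≤
        (if E q.1 q.2 then K ^ (t - 2) else 0) + t * β * K ^ (t - 2) := by
      intro q hq
      have hub : (superCount (P q.1 q.2) (t - 2) {q.1, q.2} : ℝ) ≤ K ^ (t - 2) := by
        rw [hK]; exact_mod_cast superCount_le _ _ _
      have hnn : 0 ≤ t * β * K ^ (t - 2) := by positivity
      split_ifs with hE
      · linarith
      · have hr : ¬ Rich (P q.1 q.2) β (t - 2) {q.1, q.2} :=
          fun hr => hE ⟨(mem_filter.1 hq).2, hr⟩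
        unfold Rich at hr
        push Not at hr
        rw [← hK] at hr
        have hc : ((t - 2 : ℕ) : ℝ) + 1 ≤ t := by
          rw [Nat.cast_sub ht]; push_cast; linarith
        have : (((t - 2 : ℕ) : ℝ) + 1) * β * K ^ (t - 2) ≤ t * β * K ^ (t - 2) := by gcongr
        linarith
    have h4 := h2.trans (sum_le_sum h3)
    rw [sum_add_distrib, ← sum_filter, sum_const, sum_const, nsmul_eq_mul, nsmul_eq_mul] at h4
    have h5 : (#(filter (fun q : V × V => E q.1 q.2) O) : ℝ) ≤ #{q : V × V | E q.1 q.2} := by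
      exact_mod_cast card_le_card (filter_subset_filter _ (subset_univ _))
    have h6 : (#O : ℝ) ≤ K ^ 2 := by
      have : #O ≤ Fintype.card V ^ 2 := by
        refine (card_le_univ _).trans ?_
        rw [Fintype.card_prod, sq]
      rw [hK]; exact_mod_cast this
    have h7 : α * K ^ t ≤ #{q : V × V | E q.1 q.2} * K ^ (t - 2) +
        K ^ 2 * (α / 2 * K ^ (t - 2)) := by
      have h8 : t * β ≤ α / 2 := by linarith
      refine h4.trans ?_
      gcongr
    have h8 : K ^ t = K ^ 2 * K ^ (t - 2) := by rw [← pow_add]; congr 1; omega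
    rw [h8] at h7
    refine le_of_mul_le_mul_right ?_ (by positivity : 0 < K ^ (t - 2))
    linarith
  let cod : V → V → Finset V := fun u w => {y | E u y ∧ E w y}
  obtain ⟨U, hU, hUU⟩ := exists_subset_codegree E (half_pos hα) hV (by convert hE) hβα hβα'
  obtain ⟨B₁, hB₁, h₁⟩ := exists_small_exceptional A
    (fun i j ρ => {v | v ∉ ρ ∧ Rich (P i j) β (t - #ρ - 1) (insert v ρ)}) hV hD hM hA
  obtain ⟨B₂, hB₂, h₂⟩ := exists_small_exceptional A (fun i j _ => cod i j) hV hD hM hA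
  obtain ⟨B₃, hB₃, h₃⟩ := exists_small_exceptional A
    (fun i j _ => {w | β * K ≤ #(cod i w) ∧ β * K ≤ #(cod j w)}) hV hD hM hA
  refine ⟨U, B₁ ∪ (B₂ ∪ B₃), hU, ?_, ?_⟩
  · have : (#(B₁ ∪ (B₂ ∪ B₃)) : ℝ) ≤ #B₁ + (#B₂ + #B₃) := by
      exact_mod_cast (card_union_le _ _).trans (add_le_add_right (card_union_le _ _) _)
    linarith
  intro x hx u hu hux u' hu' hux'
  simp only [mem_union, not_or] at hx
  -- Consistency spreads from edges to pairs of large codegree (`step₂`), then to all pairs in `U`: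
  -- each time, `A x` meets the large set of possible intermediate indices.
  have step : ∀ i j, i ∈ A x → j ∈ A x → E i j → s i x = s j x := by
    intro i j hi hj hij
    have hs : ({i, j} : Finset V) ⊆ A x := insert_subset hi (singleton_subset_iff.2 hj)
    obtain ⟨S, hS, hP⟩ := hij.2.exists_subset hβ hs (t := t)
      (by rw [card_pair hij.1]; omega) (fun ρ hρ hρA hρt hb => h₁ x hx.1 ρ hρA hρt i
        (hρ (by simp)) j (hρ (by simp)) hb)
    exact hP x hS
  have hpair : ∀ i j : V, #({i, j} : Finset V) ≤ t := fun i j => card_le_two.trans ht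
  have step₂ : ∀ i j, i ∈ A x → j ∈ A x → β * K ≤ #(cod i j) → s i x = s j x := by
    intro i j hi hj hij
    have := h₂ x hx.2.1 {i, j} (insert_subset hi (singleton_subset_iff.2 hj)) (hpair i j)
      i (by simp) j (by simp) hij
    obtain ⟨y, hyA, hy⟩ := not_disjoint_iff.1 this
    simp only [cod, mem_filter, mem_univ, true_and] at hy
    rw [step i y hi hyA hy.1, step j y hj hyA hy.2]
  have := h₃ x hx.2.2 {u, u'} (insert_subset hux (singleton_subset_iff.2 hux')) (hpair u u')
    u (by simp) u' (by simp) (by convert hUU u hu u' hu')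
  obtain ⟨w, hwA, hw⟩ := not_disjoint_iff.1 this
  simp only [mem_filter, mem_univ, true_and] at hw
  rw [step₂ u w hux hwA hw.1, step₂ u' w hux' hwA hw.2]

end Consistency

/-! ### Concentration -/

section Probability

open Finset
open scoped Classical

/-- Chebyshev's inequality for the number of events that occur, when every event is correlated with
at most `d` of them. -/
lemma measureReal_card_gt_le {Ω ι : Type*} [MeasurableSpace Ω] [Fintype ι] (μ : Measure Ω)
    [IsProbabilityMeasure μ] (E : ι → Set Ω) (hE : ∀ a, MeasurableSet (E a)) {d : ℕ} {q θ : ℝ}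
    (hq : ∀ a, μ.real (E a) ≤ q)
    (hd : ∀ a, #{b | μ.real (E a ∩ E b) ≠ μ.real (E a) * μ.real (E b)} ≤ d)
    (hθ : 0 < θ) (hι : 0 < Fintype.card ι) :
    μ.real {ω | (q + θ) * Fintype.card ι < #{a | ω ∈ E a}} ≤ d / (θ ^ 2 * Fintype.card ι) := by
  set n : ℝ := (Fintype.card ι : ℝ) with hn
  have hn0 : 0 < n := by rw [hn]; exact_mod_cast hι
  let X : ι → Ω → ℝ := fun a => (E a).indicator 1
  have hX : ∀ a, MemLp (X a) 2 μ := fun a => memLp_indicator_const 2 (hE a) 1 (Or.inr (by simp))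
  have hXint : ∀ a, ∫ ω, X a ω ∂μ = μ.real (E a) := fun a => integral_indicator_one (hE a)
  have hcov : ∀ a b, cov[X a, X b; μ] = μ.real (E a ∩ E b) - μ.real (E a) * μ.real (E b) := by
    intro a b
    rw [covariance_eq_sub (hX a) (hX b), hXint, hXint]
    congr 1
    rw [← integral_indicator_one ((hE a).inter (hE b))]
    congr 1
    ext ω
    by_cases h1 : ω ∈ E a <;> by_cases h2 : ω ∈ E b <;> simp [X, h1, h2]
  have hvar : Var[∑ a, X a; μ] ≤ d * n := by
    rw [variance_sum hX]
    calc _ ≤ ∑ a : ι, (d : ℝ) := by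
          refine sum_le_sum fun a _ => ?_
          calc ∑ b, cov[X a, X b; μ] ≤
              ∑ b, if μ.real (E a ∩ E b) ≠ μ.real (E a) * μ.real (E b) then (1 : ℝ) else 0 := by
                refine sum_le_sum fun b _ => ?_
                rw [hcov]
                split_ifs with h
                · have h1 : μ.real (E a ∩ E b) ≤ 1 := measureReal_le_one
                  have h2 : 0 ≤ μ.real (E a) * μ.real (E b) := by positivity
                  linarith
                · rw [not_not] at h
                  linarith
            _ = #{b | μ.real (E a ∩ E b) ≠ μ.real (E a) * μ.real (E b)} := by
                rw [card_filter]; push_cast; rfl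
            _ ≤ d := by exact_mod_cast hd a
      _ = d * n := by simp [hn]; ring
  have hS : MemLp (∑ a, X a) 2 μ := memLp_finsetSum' _ fun a _ => hX a
  have hexp : ∫ ω, (∑ a, X a) ω ∂μ ≤ q * n := by
    simp only [Finset.sum_apply]
    rw [integral_finsetSum _ fun a _ => (hX a).integrable (by norm_num)]
    calc _ ≤ ∑ a : ι, q := sum_le_sum fun a _ => (hXint a).trans_le (hq a)
      _ = q * n := by simp [hn]; ring
  have hcheb := meas_ge_le_variance_div_sq hS (c := θ * n) (by positivity)
  have hmono : μ {ω | (q + θ) * n < #{a | ω ∈ E a}} ≤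
      μ {ω | θ * n ≤ |(∑ a, X a) ω - ∫ ω, (∑ a, X a) ω ∂μ|} := by
    refine measure_mono fun ω hω => ?_
    simp only [Set.mem_ofPred_eq] at hω ⊢
    have : (∑ a, X a) ω = #{a | ω ∈ E a} := by
      simp [X, Set.indicator_apply]
    rw [this]
    refine le_trans ?_ (le_abs_self _)
    linarith
  calc μ.real {ω | (q + θ) * n < #{a | ω ∈ E a}} ≤ Var[∑ a, X a; μ] / (θ * n) ^ 2 := by
        refine ENNReal.toReal_le_of_le_ofReal ?_ (hmono.trans hcheb)
        have := variance_nonneg (∑ a, X a) μ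
        positivity
    _ ≤ d * n / (θ * n) ^ 2 := by gcongr
    _ = _ := by field_simp

variable {α : Type*}

/-- The sets that contain no element of `C`. -/
def missing (C : Finset α) : Set (Set α) := {S | ∀ c ∈ C, c ∉ S}

lemma setBernoulli_real_missing (p : unitInterval) (C : Finset α) :
    (setBernoulli Set.univ p).real (missing C) = (1 - p : ℝ) ^ #C := by
  rw [measureReal_def, setBernoulli_apply']
  have : (fun p : α → Prop => {i | p i}) ⁻¹' missing C =
      Set.pi (C : Set α) (fun _ => {q : Prop | ¬ q}) := by
    ext q
    simp [missing, Set.mem_pi]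
  rw [this, Measure.infinitePi_pi _ (fun i _ => MeasurableSet.of_discrete)]
  simp [unitInterval.symm]

/-- The condition that a random set misses `C`, meets `C`, or no condition at all. -/
def hitPattern (τ N : Prop) (C : Finset α) : Set (Set α) :=
  if N then missing C else if τ then (missing C)ᶜ else Set.univ

variable {k : ℕ}

/-- The event that all the sets with indices in `τ` meet `C`, and those with indices in `N` miss
it. -/
def hitEvent (τ N : Finset (Fin k)) (C : Finset α) : Set (Fin k → Set α) :=
  Set.univ.pi fun i => hitPattern (i ∈ τ) (i ∈ N) C

variable (p : unitInterval)

instance randomSubsets.instIsProbabilityMeasure :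
    IsProbabilityMeasure (randomSubsets α k p) := by
  unfold randomSubsets; infer_instance

lemma randomSubsets_real_pi (s : Fin k → Set (Set α)) :
    (randomSubsets α k p).real (Set.univ.pi s) = ∏ i, (setBernoulli Set.univ p).real (s i) := by
  simp [randomSubsets, measureReal_def, Measure.pi_pi, ENNReal.toReal_prod]

lemma mem_hitEvent_iff {τ N : Finset (Fin k)} (h : Disjoint τ N) {C : Finset α}
    {T : Fin k → Set α} :
    T ∈ hitEvent τ N C ↔ (∀ i ∈ τ, ∃ c ∈ C, c ∈ T i) ∧ ∀ i ∈ N, ∀ c ∈ C, c ∉ T i := by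
  simp only [hitEvent, Set.mem_univ_pi, hitPattern]
  refine ⟨fun H => ⟨fun i hi => ?_, fun i hi => ?_⟩, fun H i => ?_⟩
  · have := H i
    rw [if_neg (disjoint_left.1 h hi), if_pos hi] at this
    simpa [missing] using this
  · have := H i
    rw [if_pos hi] at this
    exact this
  · split_ifs with h1 h2
    · exact H.2 i h1
    · simpa [missing] using H.1 i h2
    · trivial

/-- The collections for which some pattern occurs at more members of the family `C` than
expected. -/
def atypicalCollections {ι : Type*} [Fintype ι] (C : ι → Finset α) (k Δ : ℕ) (θ : ℝ) :
    Set (Fin k → Set α) :=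
  {T | ∃ τ N : Finset (Fin k), Disjoint τ N ∧
    ((Δ * p : ℝ) ^ #τ * (1 - p : ℝ) ^ #N + θ) * Fintype.card ι < #{a | T ∈ hitEvent τ N (C a)}}

lemma card_hitEvent_le {ι : Type*} [Fintype ι] {C : ι → Finset α} {Δ : ℕ} {θ : ℝ}
    {T : Fin k → Set α} (hT : T ∉ atypicalCollections p C k Δ θ) {τ N : Finset (Fin k)}
    (h : Disjoint τ N) : (#{a | T ∈ hitEvent τ N (C a)} : ℝ) ≤
      ((Δ * p : ℝ) ^ #τ * (1 - p : ℝ) ^ #N + θ) * Fintype.card ι :=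
  not_lt.1 fun hlt => hT ⟨τ, N, h, hlt⟩

variable [Finite α]

/-- Missing both sets means missing their disjoint union, so the exponents add. Inclusion–exclusion
carries independence over to the complements. -/
lemma setBernoulli_real_hitPattern_inter (τ N : Prop) {C C' : Finset α}
    (h : Disjoint C C') :
    (setBernoulli Set.univ p).real (hitPattern τ N C ∩ hitPattern τ N C') =
      (setBernoulli Set.univ p).real (hitPattern τ N C) *
        (setBernoulli Set.univ p).real (hitPattern τ N C') := by
  set μ := (setBernoulli (Set.univ : Set α) p)
  have hm : ∀ s : Set (Set α), MeasurableSet s := fun s => MeasurableSet.of_discrete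
  have hu : μ.real (missing C ∩ missing C') = μ.real (missing C) * μ.real (missing C') := by
    have : missing C ∩ missing C' = missing (C ∪ C') := by
      ext S
      simp only [missing, Set.mem_inter_iff, Set.mem_ofPred_eq, mem_union]
      grind
    rw [this, setBernoulli_real_missing, setBernoulli_real_missing, setBernoulli_real_missing,
      card_union_of_disjoint h, pow_add]
  unfold hitPattern
  split_ifs with h1 h2
  · exact hu
  · rw [← Set.compl_union, probReal_compl_eq_one_sub (hm _), probReal_compl_eq_one_sub (hm _),
      probReal_compl_eq_one_sub (hm _)]
    have := measureReal_union_add_inter (μ := μ) (s := missing C) (hm (missing C'))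
    rw [hu] at this
    linear_combination -this
  · simp

lemma randomSubsets_real_hitEvent_inter (τ N : Finset (Fin k)) {C C' : Finset α}
    (h : Disjoint C C') :
    (randomSubsets α k p).real (hitEvent τ N C ∩ hitEvent τ N C') =
      (randomSubsets α k p).real (hitEvent τ N C) *
        (randomSubsets α k p).real (hitEvent τ N C') := by
  unfold hitEvent
  rw [← Set.pi_inter_distrib, randomSubsets_real_pi, randomSubsets_real_pi, randomSubsets_real_pi,
    ← prod_mul_distrib]
  exact prod_congr rfl fun i _ => setBernoulli_real_hitPattern_inter p _ _ h

/-- Coordinatewise: missing a nonempty `C` has probability at most `1 - p`, and Bernoulli's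
inequality bounds that of meeting it by `#C * p`. -/
lemma randomSubsets_real_hitEvent_le {τ N : Finset (Fin k)} (h : Disjoint τ N) {C : Finset α}
    (hC : C.Nonempty) {Δ : ℕ} (hΔ : #C ≤ Δ) :
    (randomSubsets α k p).real (hitEvent τ N C) ≤ (Δ * p : ℝ) ^ #τ * (1 - p : ℝ) ^ #N := by
  have hp0 : (0 : ℝ) ≤ p := p.2.1
  have hp1 : (0 : ℝ) ≤ 1 - p := sub_nonneg.2 p.2.2
  unfold hitEvent
  rw [randomSubsets_real_pi]
  calc _ ≤ ∏ i, ((if i ∈ τ then (Δ * p : ℝ) else 1) * (if i ∈ N then (1 - p : ℝ) else 1)) := by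
        refine prod_le_prod (fun i _ => by positivity) fun i _ => ?_
        unfold hitPattern
        by_cases hN : i ∈ N
        · have hτ : i ∉ τ := fun hτ => disjoint_left.1 h hτ hN
          simp only [hN, hτ, if_true, if_false, one_mul]
          rw [setBernoulli_real_missing]
          exact pow_le_of_le_one hp1 (by linarith) hC.card_pos.ne'
        · by_cases hτ : i ∈ τ
          · simp only [hN, hτ, if_true, if_false, mul_one]
            rw [probReal_compl_eq_one_sub MeasurableSet.of_discrete, setBernoulli_real_missing]
            have hb := one_add_mul_le_pow (a := -(p : ℝ)) (by linarith [p.2.2]) #C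
            have hc : (#C : ℝ) * p ≤ Δ * p := by gcongr
            rw [← sub_eq_add_neg] at hb
            linarith
          · simp [hN, hτ]
    _ = _ := by
        rw [prod_mul_distrib, prod_ite_mem, prod_ite_mem]
        simp

/-- With high probability, the pattern counts of a sparse family `C` of sets are close to their
expectations, simultaneously for all patterns. -/
theorem randomSubsets_real_atypicalCollections_le {ι : Type*} [Fintype ι] (C : ι → Finset α)
    {Δ d : ℕ} (hC : ∀ a, (C a).Nonempty) (hΔ : ∀ a, #(C a) ≤ Δ)
    (hd : ∀ a, #{b | ¬ Disjoint (C a) (C b)} ≤ d) {θ : ℝ} (hθ : 0 < θ)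
    (hι : 0 < Fintype.card ι) :
    (randomSubsets α k p).real (atypicalCollections p C k Δ θ) ≤
      4 ^ k * (d / (θ ^ 2 * Fintype.card ι)) := by
  set μ := randomSubsets α k p
  let I : Finset (Finset (Fin k) × Finset (Fin k)) := {q | Disjoint q.1 q.2}
  let F : Finset (Fin k) × Finset (Fin k) → Set (Fin k → Set α) := fun q =>
    {T | ((Δ * p : ℝ) ^ #q.1 * (1 - p : ℝ) ^ #q.2 + θ) * Fintype.card ι <
      #{a | T ∈ hitEvent q.1 q.2 (C a)}}
  calc _ ≤ μ.real (⋃ q ∈ I, F q) := by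
        refine measureReal_mono ?_ (measure_ne_top _ _)
        rintro T ⟨τ, N, h, hT⟩
        simp only [Set.mem_iUnion]
        exact ⟨(τ, N), by simpa [I] using h, hT⟩
    _ ≤ ∑ q ∈ I, μ.real (F q) := measureReal_biUnion_finset_le _ _
    _ ≤ ∑ q ∈ I, (d / (θ ^ 2 * Fintype.card ι) : ℝ) := by
        refine sum_le_sum fun q hq => ?_
        refine measureReal_card_gt_le μ (fun a => hitEvent q.1 q.2 (C a))
          (fun a => .univ_pi fun i => MeasurableSet.of_discrete)
          (fun a => randomSubsets_real_hitEvent_le p (mem_filter.1 hq).2 (hC a) (hΔ a))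
          (fun a => (card_le_card ?_).trans (hd a)) hθ hι
        intro b
        simp only [mem_filter, mem_univ, true_and]
        exact fun hb hdis => hb (randomSubsets_real_hitEvent_inter p _ _ hdis)
    _ = #I * (d / (θ ^ 2 * Fintype.card ι)) := by simp
    _ ≤ _ := by
        gcongr
        have : #I ≤ 4 ^ k := by
          refine (card_le_univ _).trans (le_of_eq ?_)
          simp [← mul_pow]
        exact_mod_cast this

end Probability

/-! ### Decoding a labeling -/

section Decoding

open Finset
open scoped Classical

namespace ThreeCNF

variable {X : Type*} (Φ : ThreeCNF X)

/-- The clauses in which the variable `x` appears. -/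
noncomputable def clausesWith (x : X) : Finset Φ.Clause := {c | x ∈ clauseVar c}

lemma card_clausesWith (x : X) : #(Φ.clausesWith x) = Φ.degree x := by
  rw [degree, Set.ncard_eq_toFinset_card']
  congr 1
  ext c
  simp [clausesWith]

variable {Φ}

variable {k : ℕ} (T : Fin k → Set Φ.Clause)

/-- The indices of the members of the collection `T` that mention the variable `x`. -/
noncomputable def indicesAt (x : X) : Finset (Fin k) := {i | x ∈ subsetVar (T i)}

lemma mem_indicesAt {x : X} {i : Fin k} :
    i ∈ indicesAt T x ↔ ∃ c ∈ Φ.clausesWith x, c ∈ T i := by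
  simp only [indicesAt, subsetVar, mem_filter, mem_univ, true_and, Set.mem_iUnion, clausesWith,
    exists_prop, and_comm]

lemma one_sub_le_valOf {ε : ℝ} (hm : 0 < #Φ.clauses) (φ : X → Bool)
    (h : (#{c : Φ.Clause | ¬ Satisfies φ c} : ℝ) ≤ ε * #Φ.clauses) : 1 - ε ≤ Φ.valOf φ := by
  have h1 : {c : Φ.Clause | Satisfies φ c}.ncard = #{c : Φ.Clause | Satisfies φ c} := by
    rw [Set.ncard_eq_toFinset_card']
    congr 1
    ext c
    simp
  have h2 := card_filter_add_card_filter_not (s := (univ : Finset Φ.Clause)) (Satisfies φ)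
  rw [card_univ, Fintype.card_coe] at h2
  have h3 : (#{c : Φ.Clause | Satisfies φ c} : ℝ) + #{c : Φ.Clause | ¬ Satisfies φ c} =
      #Φ.clauses := by exact_mod_cast h2
  have hm' : (0 : ℝ) < #Φ.clauses := by exact_mod_cast hm
  rw [valOf, h1, le_div_iff₀ hm']
  linarith

variable [Fintype X]

lemma card_clauseVar_le (c : Φ.Clause) : #{x | x ∈ clauseVar c} ≤ 3 := by
  refine le_trans (card_le_card ?_) (card_image_le.trans (Φ.card_le_three c.1 c.2) :
    #(c.1.image Prod.fst) ≤ 3)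
  rintro x hx
  obtain ⟨b, hb⟩ := (mem_filter.1 hx).2
  exact mem_image.2 ⟨_, hb, rfl⟩

/-- This is the dependency degree for Chebyshev: only variables sharing a clause with `x` have
events correlated with that of `x`. -/
lemma card_not_disjoint_clausesWith_le {Δ : ℕ} (hΔ : ∀ x, Φ.degree x ≤ Δ) (x : X) :
    #{y | ¬ Disjoint (Φ.clausesWith x) (Φ.clausesWith y)} ≤ 3 * Δ := by
  calc _ ≤ #((Φ.clausesWith x).biUnion fun c => ({y | y ∈ clauseVar c} : Finset X)) := by
        refine card_le_card fun y hy => ?_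
        obtain ⟨c, hc, hc'⟩ := not_disjoint_iff.1 (mem_filter.1 hy).2
        exact mem_biUnion.2 ⟨c, hc, by simpa [clausesWith] using hc'⟩
    _ ≤ #(Φ.clausesWith x) * 3 := card_biUnion_le_card_mul _ _ _ fun c _ => card_clauseVar_le c
    _ ≤ 3 * Δ := by
        rw [card_clausesWith, mul_comm]
        exact Nat.mul_le_mul_left _ (hΔ x)

/-- Converts an exceptional fraction of the variables into one of the clauses, and makes the number
of clauses grow with `n`. -/
lemma card_le_three_mul_card_clauses (h : ∀ x, 1 ≤ Φ.degree x) :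
    Fintype.card X ≤ 3 * #Φ.clauses := by
  calc Fintype.card X
      ≤ #((univ : Finset Φ.Clause).biUnion fun c => ({y | y ∈ clauseVar c} : Finset X)) := by
        rw [← card_univ]
        refine card_le_card fun x _ => ?_
        obtain ⟨c, hc⟩ := card_pos.1 ((h x).trans (card_clausesWith Φ x).ge)
        exact mem_biUnion.2 ⟨c, mem_univ _, by simpa [clausesWith] using hc⟩
    _ ≤ #(univ : Finset Φ.Clause) * 3 :=
        card_biUnion_le_card_mul _ _ _ fun c _ => card_clauseVar_le c
    _ = _ := by rw [card_univ, Fintype.card_coe, mul_comm]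

lemma valOf_le_val (φ : X → Bool) : Φ.valOf φ ≤ Φ.val :=
  le_ciSup (Set.finite_range _).bddAbove φ

variable {T} {t : ℕ}

/-- The label of `T i` as a total assignment. -/
noncomputable def labelAt (σ : (Φ.labelCover T t).LeftLabeling) (i : Fin k) (x : X) : Bool :=
  -- The default is harmless: labels are compared at `x` only for indices in `indicesAt T x`.
  if h : x ∈ subsetVar (T i) then (σ i).1 ⟨x, h⟩ else false

lemma exists_labelAt_eq (σ : (Φ.labelCover T t).LeftLabeling) {S : (Φ.labelCover T t).V}
    (h : LabelCover.WeaklyAgrees σ S) : ∃ i ∈ S.1, ∃ j ∈ S.1, i ≠ j ∧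
      ∀ x, S.1 ⊆ indicesAt T x → labelAt σ i x = labelAt σ j x := by
  obtain ⟨i, j, hi, hj, hij, he⟩ := h
  refine ⟨i, hi, j, hj, hij, fun x hx => ?_⟩
  have hx' : ∀ l ∈ S.1, x ∈ subsetVar (T l) := fun l hl => (mem_filter.1 (hx hl)).2
  have := congrFun he ⟨x, Set.mem_iInter₂.2 hx'⟩
  simp only [labelAt, dif_pos (hx' i hi), dif_pos (hx' j hj)]
  exact this

/-- For `k ≥ 2 t`, the binomial coefficient is at least `(k / 2) ^ t / t!`, whence the density `δ /
(2 ^ t * t!)`. -/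
lemma card_agreeing_ge (σ : (Φ.labelCover T t).LeftLabeling) {δ : ℝ} (hδ : 0 ≤ δ)
    (htk : 2 * t ≤ k) (h : δ ≤ LabelCover.wvalOf σ) :
    δ / (2 ^ t * t.factorial) * (k : ℝ) ^ t ≤ #{S : Finset (Fin k) | #S = t ∧
      ∃ i ∈ S, ∃ j ∈ S, i ≠ j ∧ ∀ x, S ⊆ indicesAt T x → labelAt σ i x = labelAt σ j x} := by
  have hcard : Nat.card (Φ.labelCover T t).V = k.choose t := by
    change Nat.card {s : Finset (Fin k) // #s = t} = _
    rw [Nat.card_eq_fintype_card, Fintype.card_finset_len, Fintype.card_fin]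
  have hch0 : (0 : ℝ) < k.choose t := by exact_mod_cast Nat.choose_pos (by omega)
  have h1 : δ * k.choose t ≤ {v | LabelCover.WeaklyAgrees σ v}.ncard := by
    rw [LabelCover.wvalOf, hcard, le_div_iff₀ hch0] at h
    exact h
  have h2 : {v | LabelCover.WeaklyAgrees σ v}.ncard ≤ #{S : Finset (Fin k) | #S = t ∧
      ∃ i ∈ S, ∃ j ∈ S, i ≠ j ∧ ∀ x, S ⊆ indicesAt T x → labelAt σ i x = labelAt σ j x} := by
    rw [← Set.ncard_coe_finset]
    refine Set.ncard_le_ncard_of_injOn (fun v => v.1) (fun v hv => ?_)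
      (fun a _ b _ hab => Subtype.ext hab) (Finset.finite_toSet _)
    simp only [coe_filter, mem_univ, true_and, Set.mem_ofPred_eq]
    exact ⟨v.2, exists_labelAt_eq σ hv⟩
  have h3 : (k / 2 : ℝ) ^ t / t.factorial ≤ k.choose t := by
    refine le_trans ?_ (Nat.pow_le_choose (α := ℝ) t k)
    gcongr
    have : (k : ℝ) ≤ 2 * (k + 1 - t : ℕ) := by
      exact_mod_cast (by omega : k ≤ 2 * (k + 1 - t))
    linarith
  calc δ / (2 ^ t * t.factorial) * (k : ℝ) ^ t = δ * ((k / 2 : ℝ) ^ t / t.factorial) := by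
        rw [div_pow]; field_simp
    _ ≤ δ * k.choose t := by gcongr
    _ ≤ _ := h1.trans (by exact_mod_cast h2)

/-- For a pseudorandom collection `T`, a labeling with large weak agreement value can be decoded to
an assignment that satisfies almost all clauses. -/
theorem exists_assignment_of_le_wvalOf (σ : (Φ.labelCover T t).LeftLabeling) {δ β M M' D : ℝ}
    {Δ : ℕ} (hΔ : ∀ x, Φ.degree x ≤ Δ) (ht : 2 ≤ t) (htk : 2 * t ≤ k) (hδ : 0 ≤ δ)
    (hσ : δ ≤ LabelCover.wvalOf σ) (hβ : 0 < β) (hβt : β * (2 * t) ≤ δ / (2 ^ t * t.factorial))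
    (hβδ : β ≤ (δ / (2 ^ t * t.factorial) / 2) ^ 2 / 64) (hβδ' : β ≤ (δ / (2 ^ t * t.factorial) / 2) / 4)
    (hD : 1 ≤ D) (hM : 0 ≤ M)
    (hA : ∀ τ N : Finset (Fin k), β * k ≤ #N → #τ ≤ t →
      (#{x | τ ⊆ indicesAt T x ∧ Disjoint (indicesAt T x) N} : ℝ) ≤ M * (D / k) ^ #τ)
    (hN : ∀ N : Finset (Fin k), β * k ≤ #N → (#{c : Φ.Clause | ∀ i ∈ N, c ∉ T i} : ℝ) ≤ M') :
    ∃ φ : X → Bool, (#{c : Φ.Clause | ¬ Satisfies φ c} : ℝ) ≤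
      Δ * (3 * ((t + 1) * (t ^ 2 * (M * D ^ t)))) + M' := by
  obtain ⟨U, B, hU, hB, hUB⟩ := exists_consistent_indices (indicesAt T) (labelAt σ) ht
    (α := δ / (2 ^ t * t.factorial)) (M := M) (D := D) hβ hβt hβδ hβδ' (by simp; omega) hD hM
    (by simpa using card_agreeing_ge σ hδ htk hσ) (fun τ N h₁ h₂ => by
      rw [Fintype.card_fin] at h₁ ⊢
      convert hA τ N h₁ h₂)
  rw [Fintype.card_fin] at hU
  let φ : X → Bool := fun x =>
    if h : ∃ u, u ∈ U ∧ u ∈ indicesAt T x then labelAt σ h.choose x else false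
  refine ⟨φ, ?_⟩
  -- If `c ∈ T i` with `i ∈ U`, the label of `T i` satisfies some literal of `c`. Unless its
  -- variable is in `B`, `φ` gives it the same value.
  have hsub : ({c : Φ.Clause | ¬ Satisfies φ c} : Finset Φ.Clause) ⊆
      B.biUnion (fun x => Φ.clausesWith x) ∪
        ({c | ∀ i ∈ U, c ∉ T i} : Finset Φ.Clause) := by
    intro c hc
    by_contra hcon
    simp only [mem_union, mem_biUnion, mem_filter, mem_univ, true_and, not_or, not_exists, not_and,
      not_forall, not_not, clausesWith] at hcon hc
    obtain ⟨hcB, i, hiU, hci⟩ := hcon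
    obtain ⟨l, hl, hlv, hle⟩ := (σ i).2 c hci
    refine hc ⟨l, hl, ?_⟩
    have hlc : l.1 ∈ clauseVar c := ⟨l.2, hl⟩
    have hiA : i ∈ indicesAt T l.1 := mem_filter.2 ⟨mem_univ _, hlv⟩
    have hex : ∃ u, u ∈ U ∧ u ∈ indicesAt T l.1 := ⟨i, hiU, hiA⟩
    have hφ : φ l.1 = labelAt σ hex.choose l.1 := dif_pos hex
    rw [hφ, hUB l.1 (fun hb => hcB _ hb hlc) _ hex.choose_spec.1 hex.choose_spec.2 i hiU hiA,
      labelAt, dif_pos hlv]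
    exact hle
  have hc : #({c : Φ.Clause | ¬ Satisfies φ c} : Finset Φ.Clause) ≤
      #B * Δ + #{c : Φ.Clause | ∀ i ∈ U, c ∉ T i} := by
    refine (card_le_card hsub).trans ((card_union_le _ _).trans (Nat.add_le_add_right ?_ _))
    exact card_biUnion_le_card_mul _ _ _ fun x _ => (card_clausesWith Φ x).trans_le (hΔ x)
  calc (#{c : Φ.Clause | ¬ Satisfies φ c} : ℝ) ≤
      #B * Δ + #{c : Φ.Clause | ∀ i ∈ U, c ∉ T i} := by exact_mod_cast hc
    _ ≤ (3 * ((t + 1) * (t ^ 2 * (M * D ^ t)))) * Δ + M' := by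
        gcongr
        exact hN U hU
    _ = _ := by ring

end ThreeCNF

end Decoding

/-! ### Choice of the constants and conclusion. -/

section Main

open Finset
open scoped Classical

/-- Exponential decay beats the polynomial factor from the union bounds. This fixes `C` before `k`.
-/
lemma exists_gt_exp_neg_mul_pow_le {β ε : ℝ} (hβ : 0 < β) (hε : 0 < ε) (a b : ℝ) (t : ℕ) :
    ∃ C : ℝ, 1 ≤ C ∧ Real.exp (-(β * C)) * (a * C ^ t + b) ≤ ε := by
  have h1 := (Real.tendsto_pow_mul_exp_neg_atTop_nhds_zero t).const_mul (a / β ^ t)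
  have h2 := (Real.tendsto_pow_mul_exp_neg_atTop_nhds_zero 0).const_mul b
  have h3 := h1.add h2
  simp only [mul_zero, add_zero, pow_zero, one_mul] at h3
  obtain ⟨y, hy, hy1⟩ := ((h3.eventually_le_const hε).and
    (Filter.eventually_ge_atTop β)).exists
  refine ⟨y / β, (one_le_div hβ).2 hy1, le_trans (le_of_eq ?_) hy⟩
  rw [mul_div_cancel₀ _ hβ.ne', div_pow]
  field_simp

lemma one_sub_pow_le_exp_neg {p : ℝ} (hp : p ≤ 1) {N : ℕ} {r : ℝ} (h : r ≤ p * N) :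
    (1 - p) ^ N ≤ Real.exp (-r) := by
  calc (1 - p) ^ N ≤ Real.exp (-p) ^ N :=
        pow_le_pow_left₀ (by linarith) (Real.one_sub_le_exp_neg p) N
    _ = Real.exp (-(p * N)) := by rw [← Real.exp_nat_mul]; congr 1; ring
    _ ≤ _ := Real.exp_le_exp.2 (by linarith)

/-- For a typical collection `T`, the Label Cover instance has small weak agreement value. -/
theorem ThreeCNF.wval_lt_of_notMem_atypicalCollections {X : Type*} [Fintype X] {Φ : ThreeCNF X}
    {k t d : ℕ} (T : Fin k → Set Φ.Clause) (p : unitInterval) {ε δ β γ θ C : ℝ}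
    (hdeg : ∀ x, Φ.degree x ≤ d) (hnm : (Fintype.card X : ℝ) ≤ 3 * #Φ.clauses)
    (hm : 0 < #Φ.clauses) (ht : 2 ≤ t) (htk : 2 * t ≤ k) (hδ : 0 < δ) (hβ : 0 < β)
    (hβt : β * (2 * t) ≤ δ / (2 ^ t * t.factorial))
    (hβδ : β ≤ (δ / (2 ^ t * t.factorial) / 2) ^ 2 / 64)
    (hβδ' : β ≤ (δ / (2 ^ t * t.factorial) / 2) / 4) (hD : 1 ≤ d * C) (hDk : d * C / k ≤ 1)
    (hp : (p : ℝ) = C / k) (hγ : 0 < γ) (hθ : θ = γ * (d * C / k) ^ t)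
    (hγN : ∀ N : Finset (Fin k), β * k ≤ #N → (1 - p : ℝ) ^ #N ≤ γ)
    (hC : γ * (18 * d * ((t + 1) * t ^ 2 * d ^ t) * C ^ t + 2) ≤ ε) (hval : Φ.val < 1 - ε)
    (hT₁ : T ∉ atypicalCollections p Φ.clausesWith k d θ)
    (hT₂ : T ∉ atypicalCollections p (fun c : Φ.Clause => {c}) k 1 θ) :
    (Φ.labelCover T t).wval < δ := by
  have hk0 : (0 : ℝ) < k := by exact_mod_cast (by omega : 0 < k)
  have hDk0 : 0 < d * C / k := by positivity
  by_contra hTG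
  obtain ⟨σ, hσ⟩ : ∃ σ : (Φ.labelCover T t).LeftLabeling, δ ≤ LabelCover.wvalOf σ := by
    by_contra! hlt
    refine hTG ?_
    change (⨆ σ, LabelCover.wvalOf σ) < δ
    have : ∀ u, Finite ((Φ.labelCover T t).LeftAlphabet u) := (Φ.labelCover T t).finite_left
    have : Finite (Φ.labelCover T t).U := (Φ.labelCover T t).finite_U
    rcases isEmpty_or_nonempty (Φ.labelCover T t).LeftLabeling with h | h
    · rwa [Real.iSup_of_isEmpty]
    · obtain ⟨σ, hσ⟩ := exists_eq_ciSup_of_finite (f := fun σ : (Φ.labelCover T t).LeftLabeling =>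
        LabelCover.wvalOf σ)
      rw [← hσ]
      exact hlt σ
  have hA : ∀ τ N : Finset (Fin k), β * k ≤ #N → #τ ≤ t →
      (#{x | τ ⊆ ThreeCNF.indicesAt T x ∧ Disjoint (ThreeCNF.indicesAt T x) N} : ℝ) ≤
        2 * γ * Fintype.card X * (d * C / k) ^ #τ := by
    intro τ N hN hτ
    by_cases hdis : Disjoint τ N
    · have h1 : ({x | τ ⊆ ThreeCNF.indicesAt T x ∧ Disjoint (ThreeCNF.indicesAt T x) N} : Finset X) ⊆
          ({x | T ∈ hitEvent τ N (Φ.clausesWith x)} : Finset X) := by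
        intro x hx
        simp only [mem_filter, mem_univ, true_and] at hx ⊢
        refine (mem_hitEvent_iff hdis).2 ⟨fun i hi => ThreeCNF.mem_indicesAt T |>.1 (hx.1 hi), ?_⟩
        intro i hi c hc hci
        exact disjoint_left.1 hx.2 ((ThreeCNF.mem_indicesAt T).2 ⟨c, hc, hci⟩) hi
      have h2 : (#{x | τ ⊆ ThreeCNF.indicesAt T x ∧ Disjoint (ThreeCNF.indicesAt T x) N} : ℝ) ≤
        #{x | T ∈ hitEvent τ N (Φ.clausesWith x)} := by exact_mod_cast card_le_card h1
      refine h2.trans ((card_hitEvent_le p hT₁ hdis).trans ?_)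
      -- With this `θ`, the deviation is at most the bound on the main term for every `#τ ≤ t`,
      -- because `d * C / k ≤ 1`. Hence the factor 2 in `hA`.
      have h3 : θ ≤ γ * (d * C / k) ^ #τ := by
        rw [hθ]
        exact mul_le_mul_of_nonneg_left (pow_le_pow_of_le_one hDk0.le hDk hτ) hγ.le
      have h4 : (d * p : ℝ) ^ #τ * (1 - p : ℝ) ^ #N ≤ (d * C / k) ^ #τ * γ := by
        rw [hp, ← mul_div_assoc]
        rw [← hp]
        exact mul_le_mul_of_nonneg_left (hγN N hN) (by positivity)
      calc _ ≤ ((d * C / k) ^ #τ * γ + γ * (d * C / k) ^ #τ) * Fintype.card X := by gcongr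
        _ = _ := by ring
    · have h1 : ({x | τ ⊆ ThreeCNF.indicesAt T x ∧ Disjoint (ThreeCNF.indicesAt T x) N} : Finset X) = ∅ :=
        filter_eq_empty_iff.2 fun x _ hx => hdis (hx.2.mono_left hx.1)
      rw [h1, card_empty, Nat.cast_zero]
      positivity
  have hN : ∀ N : Finset (Fin k), β * k ≤ #N →
      (#{c : Φ.Clause | ∀ i ∈ N, c ∉ T i} : ℝ) ≤ 2 * γ * #Φ.clauses := by
    intro N hN
    have h1 := card_hitEvent_le p hT₂ (disjoint_empty_left N)
    simp only [mem_hitEvent_iff (disjoint_empty_left N), notMem_empty, false_imp_iff,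
      implies_true, true_and, mem_singleton, forall_eq, card_empty, pow_zero, one_mul,
      Fintype.card_coe] at h1
    refine h1.trans ?_
    have h3 : θ ≤ γ := by
      rw [hθ]
      exact mul_le_of_le_one_right hγ.le (pow_le_one₀ hDk0.le hDk)
    have h4 := hγN N hN
    calc _ ≤ (γ + γ) * (#Φ.clauses : ℝ) := by gcongr
      _ = _ := by ring
  obtain ⟨φ, hφ⟩ := ThreeCNF.exists_assignment_of_le_wvalOf σ hdeg ht htk hδ.le hσ hβ hβt hβδ hβδ' hD (by positivity) hA hN
  have hunsat : (#{c : Φ.Clause | ¬ ThreeCNF.Satisfies φ c} : ℝ) ≤ ε * #Φ.clauses := by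
    refine hφ.trans ?_
    calc d * (3 * ((t + 1) * (t ^ 2 * (2 * γ * Fintype.card X * (d * C) ^ t)))) +
          2 * γ * #Φ.clauses
        ≤ d * (3 * ((t + 1) * (t ^ 2 * (2 * γ * (3 * #Φ.clauses) * (d * C) ^ t)))) +
          2 * γ * #Φ.clauses := by gcongr
      _ = γ * (18 * d * ((t + 1) * t ^ 2 * d ^ t) * C ^ t + 2) * #Φ.clauses := by
          rw [mul_pow]; ring
      _ ≤ ε * #Φ.clauses := by gcongr
  have := (ThreeCNF.one_sub_le_valOf hm φ hunsat).trans (ThreeCNF.valOf_le_val φ)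
  linarith

/-- The constants are chosen in the order `β`, `C`, `k₀`, `θ`, `n₀`; only the last two depend on
`k`. The clause `C ≤ k₀` guarantees that `C / k` is a probability, so the quantifier over `p` is not
vacuous. -/
theorem theorem4 (ε δ : ℝ) (hε : 0 < ε) (hδ : 0 < δ) (Δ t : ℕ) (ht : 2 ≤ t) :
    ∃ C : ℝ, 0 < C ∧ ∃ k₀ : ℕ, C ≤ k₀ ∧
      ∀ k : ℕ, k₀ ≤ k → ∀ p : unitInterval, (p : ℝ) = C / k →
        ∀ η : ℝ, 0 < η → ∃ n₀ : ℕ,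
          ∀ (X : Type*) [Fintype X], n₀ ≤ Fintype.card X →
            ∀ Φ : ThreeCNF X, (∀ x : X, 1 ≤ Φ.degree x ∧ Φ.degree x ≤ Δ) →
              Φ.val < 1 - ε →
                1 - η ≤ (randomSubsets Φ.Clause k p).real
                  {T : Fin k → Set Φ.Clause | (Φ.labelCover T t).wval < δ} := by
  -- `Δ` may be 0, while `1 ≤ d * C` is needed below.
  obtain ⟨d, hd1, hΔd⟩ : ∃ d : ℕ, 1 ≤ d ∧ Δ ≤ d := ⟨Δ + 1, by omega, by omega⟩
  have hd1' : (1 : ℝ) ≤ d := by exact_mod_cast hd1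
  obtain ⟨α, hα⟩ : ∃ α : ℝ, α = δ / (2 ^ t * t.factorial) := ⟨_, rfl⟩
  have hα0 : 0 < α := by rw [hα]; positivity
  have ht0 : (0 : ℝ) < t := by positivity
  obtain ⟨β, hβ, hβt, hβα, hβα'⟩ : ∃ β : ℝ, 0 < β ∧ β * (2 * t) ≤ α ∧ β ≤ (α / 2) ^ 2 / 64 ∧
      β ≤ (α / 2) / 4 := by
    refine ⟨min (α / (2 * t)) (min ((α / 2) ^ 2 / 64) ((α / 2) / 4)), ?_, ?_, ?_, ?_⟩
    · simp only [lt_min_iff]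
      refine ⟨?_, ?_, ?_⟩ <;> positivity
    · rw [← le_div_iff₀ (by positivity)]
      exact min_le_left _ _
    · exact (min_le_right _ _).trans (min_le_left _ _)
    · exact (min_le_right _ _).trans (min_le_right _ _)
  obtain ⟨C, hC1, hC⟩ := exists_gt_exp_neg_mul_pow_le hβ hε
    (18 * d * ((t + 1) * t ^ 2 * d ^ t)) 2 t
  set γ : ℝ := Real.exp (-(β * C)) with hγ
  have hγ0 : 0 < γ := Real.exp_pos _
  have hD : 1 ≤ d * C := one_le_mul_of_one_le_of_one_le hd1' hC1
  refine ⟨C, by linarith, max (2 * t) ⌈d * C⌉₊, ?_, ?_⟩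
  · have h1 : C ≤ d * C := le_mul_of_one_le_left (by linarith) hd1'
    exact (h1.trans (Nat.le_ceil _)).trans (by exact_mod_cast le_max_right _ _)
  intro k hk p hp η hη
  have htk : 2 * t ≤ k := (le_max_left _ _).trans hk
  have hk0 : (0 : ℝ) < k := by exact_mod_cast (by omega : 0 < k)
  have hDk : d * C / k ≤ 1 := by
    rw [div_le_one hk0]
    exact (Nat.le_ceil _).trans (by exact_mod_cast (le_max_right _ _).trans hk)
  have hDk0 : 0 < d * C / k := by positivity
  obtain ⟨θ, hθ⟩ : ∃ θ : ℝ, θ = γ * (d * C / k) ^ t := ⟨_, rfl⟩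
  have hθ0 : 0 < θ := by rw [hθ]; positivity
  -- The term `3 * d` pays for the variable counts and `3` for the clause counts, as there are at
  -- least `n / 3` clauses.
  refine ⟨max 1 ⌈4 ^ k * (3 * d + 3) / (θ ^ 2 * η)⌉₊, ?_⟩
  intro X _ hn Φ hdeg hval
  have hn1 : 1 ≤ Fintype.card X := (le_max_left _ _).trans hn
  have hdeg' : ∀ x, Φ.degree x ≤ d := fun x => (hdeg x).2.trans hΔd
  have hnm := Φ.card_le_three_mul_card_clauses fun x => (hdeg x).1
  have hm1 : 0 < #Φ.clauses := by omega
  have hn0 : (0 : ℝ) < Fintype.card X := by exact_mod_cast hn1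
  have hm0 : (0 : ℝ) < #Φ.clauses := by exact_mod_cast hm1
  have hnm' : (Fintype.card X : ℝ) ≤ 3 * #Φ.clauses := by exact_mod_cast hnm
  have hη' : 4 ^ k * (3 * d / (θ ^ 2 * Fintype.card X)) + 4 ^ k * (1 / (θ ^ 2 * #Φ.clauses)) ≤ η := by
    have h1 : 4 ^ k * (3 * d + 3) / (θ ^ 2 * η) ≤ Fintype.card X :=
      (Nat.le_ceil _).trans (by exact_mod_cast (le_max_right _ _).trans hn)
    rw [div_le_iff₀ (by positivity)] at h1
    have h2 : 1 / (θ ^ 2 * (#Φ.clauses : ℝ)) ≤ 3 / (θ ^ 2 * Fintype.card X) := by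
      rw [div_le_div_iff₀ (by positivity) (by positivity)]
      have : θ ^ 2 * (Fintype.card X : ℝ) ≤ θ ^ 2 * (3 * #Φ.clauses) := by gcongr
      linarith
    calc _ ≤ (4 : ℝ) ^ k * (3 * d / (θ ^ 2 * Fintype.card X)) +
          4 ^ k * (3 / (θ ^ 2 * Fintype.card X)) := by gcongr
      _ = 4 ^ k * (3 * d + 3) / (θ ^ 2 * Fintype.card X) := by ring
      _ ≤ η := by
          rw [div_le_iff₀ (by positivity)]
          linarith
  have hp1 : (p : ℝ) ≤ 1 := p.2.2
  have hγN : ∀ N : Finset (Fin k), β * k ≤ #N → (1 - p : ℝ) ^ #N ≤ γ := by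
    intro N hN
    refine one_sub_pow_le_exp_neg hp1 ?_
    calc β * C = C / k * (β * k) := by field_simp
      _ ≤ p * #N := by rw [hp]; gcongr
  set μ := randomSubsets Φ.Clause k p
  let G : Set (Fin k → Set Φ.Clause) := {T | (Φ.labelCover T t).wval < δ}
  let B₁ : Set (Fin k → Set Φ.Clause) := atypicalCollections p Φ.clausesWith k d θ
  let B₂ : Set (Fin k → Set Φ.Clause) := 
    atypicalCollections p (fun c : Φ.Clause => {c}) k 1 θ
  have hB₁ : μ.real B₁ ≤ 4 ^ k * (3 * d / (θ ^ 2 * Fintype.card X)) := by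
    have := randomSubsets_real_atypicalCollections_le (k := k) p Φ.clausesWith
      (fun x => card_pos.1 ((hdeg x).1.trans (Φ.card_clausesWith x).ge))
      (fun x => (Φ.card_clausesWith x).trans_le (hdeg' x))
      (fun x => by convert ThreeCNF.card_not_disjoint_clausesWith_le hdeg' x) hθ0 hn1
    push_cast at this
    exact this
  have hB₂ : μ.real B₂ ≤ 4 ^ k * (1 / (θ ^ 2 * #Φ.clauses)) := by
    have := randomSubsets_real_atypicalCollections_le (k := k) p (fun c : Φ.Clause => {c}) (Δ := 1)
      (d := 1) (fun c => singleton_nonempty c) (fun c => (card_singleton c).le)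
      (fun c => card_le_one.2 fun a ha b hb => by simp_all) hθ0
      (by rwa [Fintype.card_coe])
    rw [Fintype.card_coe, Nat.cast_one (R := ℝ)] at this
    exact this
  have hcover : Set.univ ⊆ G ∪ (B₁ ∪ B₂) := by
    intro T _
    by_contra hT
    simp only [Set.mem_union, not_or] at hT
    obtain ⟨hTG, hT₁, hT₂⟩ := hT
    exact hTG (ThreeCNF.wval_lt_of_notMem_atypicalCollections T p hdeg' hnm' hm1 ht htk hδ hβ
      (by rwa [← hα]) (by rwa [← hα]) (by rwa [← hα]) hD hDk hp hγ0 hθ hγN hC hval hT₁ hT₂)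
  have h1 : (1 : ℝ) ≤ μ.real (G ∪ (B₁ ∪ B₂)) := by
    rw [← probReal_univ (μ := μ)]
    exact measureReal_mono hcover (measure_ne_top _ _)
  have h2 : μ.real (G ∪ (B₁ ∪ B₂)) ≤ μ.real G + (μ.real B₁ + μ.real B₂) :=
    (measureReal_union_le _ _).trans (by gcongr; exact measureReal_union_le _ _)
  change 1 - η ≤ μ.real G
  linarith

end Main
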